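/- Let $\mathcal{H}$ be a complex Hilbert space (of arbitrary dimension). Let $\mathrm{Isom}(\mathcal{H})=\mathcal{H}\rtimes\mathcal{U}(\mathcal{H})$ be its group of affine isometries, i.e. the group of all maps $v\mapsto Uv+b$ with $U$ a ($\mathbf{C}$-linear) unitary operator on $\mathcal{H}$ and $b\in\mathcal{H}$, endowed with the product of the norm topology on $\mathcal{H}$ and the operator norm topology on $\mathcal{U}(\mathcal{H})$. (1) The topological group $\mathrm{Isom}(\mathcal{H})$ is exponential: for every $g\in\mathrm{Isom}(\mathcal{H})$ there is a continuous homomorphism $\beta:\mathbf{R}\to\mathrm{Isom}(\mathcal{H})$ such that $\beta(1)=g$. (2) Consequently, every action of $\mathbf{Z}$ on $\mathcal{H}$ by affine isometries extends to a continuous action of $\mathbf{R}$ by affine isometries: for every homomorphism $\alpha:\mathbf{Z}\to\mathrm{Isom}(\mathcal{H})$ there is a continuous homomorphism $\beta:\mathbf{R}\to\mathrm{Isom}(\mathcal{H})$ such that $\beta(n)=\alpha(n)$ for all $n\in\mathbf{Z}$ and such that the map $\mathbf{R}\times\mathcal{H}\to\mathcal{H}$, $(t,v)\mapsto\beta(t)v$,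 is continuous. -/

import Mathlib

/-- A topological group `G` is exponential if every `g ∈ G` lies on a one-parameter subgroup:
there is a continuous homomorphism `β : ℝ → G` with `β 1 = g`. -/
def IsExponentialGroup (G : Type*) [Group G] [TopologicalSpace G] [IsTopologicalGroup G] : Prop :=
  ∀ g : G, ∃ β : Multiplicative ℝ →* G, Continuous β ∧ β (Multiplicative.ofAdd 1) = g

namespace AffineIsometryGroup

section

variable (H : Type*) [NormedAddCommGroup H] [InnerProductSpace ℂ H] [CompleteSpace H]

/-- The identification of the group of (complex-)affine isometries `v ↦ U v + b` of `H` with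
`H ⋊ U(H)`, as a set `H × U(H)`: the isometry is sent to `(b, U)`. -/
noncomputable def equivProdUnitary : (H ≃ᵃⁱ[ℂ] H) ≃ H × unitary (H →L[ℂ] H) where
  toFun g := (g 0, Unitary.linearIsometryEquiv.symm g.linearIsometryEquiv)
  invFun p := (Unitary.linearIsometryEquiv p.2).toAffineIsometryEquiv.trans
    (AffineIsometryEquiv.vaddConst ℂ p.1)
  left_inv g := by
    ext v
    have h := g.map_vadd 0 v
    simpa using h.symm
  right_inv p := by
    refine Prod.ext (by simp) ?_
    ext v
    have h := ((Unitary.linearIsometryEquiv p.2).toAffineIsometryEquiv.trans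
      (AffineIsometryEquiv.vaddConst ℂ p.1)).map_vsub v 0
    simp only [vsub_eq_sub, sub_zero] at h
    refine h.trans ?_
    simp
    rfl

/-- The topology on the group of affine isometries of `H`: the product topology on `H × U(H)`,
for the norm topology on `H` and the operator norm topology on `U(H)`. -/
noncomputable instance instTopologicalSpace : TopologicalSpace (H ≃ᵃⁱ[ℂ] H) :=
  TopologicalSpace.induced (equivProdUnitary H) inferInstance

variable {H}

theorem apply_eq (g : H ≃ᵃⁱ[ℂ] H) (v : H) :
    g v = ((equivProdUnitary H g).2 : H →L[ℂ] H) v + (equivProdUnitary H g).1 := by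
  have h := g.map_vadd 0 v
  simpa [equivProdUnitary] using h

theorem continuous_equivProdUnitary : Continuous (equivProdUnitary H) :=
  continuous_induced_dom

theorem equivProdUnitary_mul (g h : H ≃ᵃⁱ[ℂ] H) :
    equivProdUnitary H (g * h) =
      (((equivProdUnitary H g).2 : H →L[ℂ] H) (equivProdUnitary H h).1 + (equivProdUnitary H g).1,
        (equivProdUnitary H g).2 * (equivProdUnitary H h).2) := by
  refine Prod.ext ?_ ?_
  · exact apply_eq g (h 0)
  · ext v
    rfl

theorem equivProdUnitary_inv (g : H ≃ᵃⁱ[ℂ] H) :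
    equivProdUnitary H g⁻¹ =
      (-((star (equivProdUnitary H g).2 : unitary (H →L[ℂ] H)) : H →L[ℂ] H)
        (equivProdUnitary H g).1, star (equivProdUnitary H g).2) := by
  have h2 : (equivProdUnitary H g⁻¹).2 = star (equivProdUnitary H g).2 := by
    have h := congrArg Prod.snd (equivProdUnitary_mul g⁻¹ g)
    rw [inv_mul_cancel] at h
    have h1 : (equivProdUnitary H 1).2 = 1 := by
      ext v
      rfl
    exact eq_inv_of_mul_eq_one_left (h.symm.trans h1)
  refine Prod.ext ?_ h2
  have h1 : g⁻¹ (g 0) = 0 := g.symm_apply_apply 0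
  rw [apply_eq g⁻¹ (g 0), h2] at h1
  exact eq_neg_of_add_eq_zero_right h1

instance instIsTopologicalGroup : IsTopologicalGroup (H ≃ᵃⁱ[ℂ] H) where
  continuous_mul := by
    refine continuous_induced_rng.2 ?_
    have h1 : Continuous fun p : (H ≃ᵃⁱ[ℂ] H) × (H ≃ᵃⁱ[ℂ] H) => equivProdUnitary H p.1 :=
      continuous_equivProdUnitary.comp continuous_fst
    have h2 : Continuous fun p : (H ≃ᵃⁱ[ℂ] H) × (H ≃ᵃⁱ[ℂ] H) => equivProdUnitary H p.2 :=
      continuous_equivProdUnitary.comp continuous_snd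
    simp only [Function.comp_def, equivProdUnitary_mul]
    exact (((continuous_subtype_val.comp h1.snd).clm_apply h2.fst).add h1.fst).prodMk
      (h1.snd.mul h2.snd)
  continuous_inv := by
    refine continuous_induced_rng.2 ?_
    have h1 : Continuous fun g : H ≃ᵃⁱ[ℂ] H => equivProdUnitary H g :=
      continuous_equivProdUnitary
    simp only [Function.comp_def, equivProdUnitary_inv]
    exact ((continuous_subtype_val.comp h1.snd.star).clm_apply h1.fst).neg.prodMk h1.snd.star

end

end AffineIsometryGroup

/-! Write `g` as `v ↦ U v + b` and `U = exp (iA)`, with `A` self-adjoint and spectrum in `[-π, π]`.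
Put `ψ_t(z) = ∫₀ᵗ exp (isz) ds`; for every vector `c`, `t ↦ ψ_t(A) c` is a cocycle for `exp (itA)`,
so the two form a one-parameter group. It passes through `g` at time 1 when `ψ₁(A) c = b`, which is
solvable because `ψ₁` vanishes only at nonzero multiples of `2π`, off the spectrum of `A`. The
logarithm is discontinuous at `-1`, so the continuous calculus of `U` alone does not give `A`.
Instead `arccos (Re U)` gives the modulus of the angle and a symmetry `J` with `Im U = J |Im U|`
gives its sign. -/

open scoped ComplexStarModule

/-! ### Self-adjoint logarithms of unitaries -/

section Logarithm

variable {H : Type*} [NormedAddCommGroup H] [InnerProductSpace ℂ H] [CompleteSpace H]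

/-- A self-adjoint operator `S` has a polar decomposition `S = J |S|` where `J` is a self-adjoint
symmetry commuting with every self-adjoint operator that commutes with `S`. -/
theorem IsSelfAdjoint.exists_symmetry_mul_abs {S : H →L[ℂ] H} (hS : IsSelfAdjoint S) :
    ∃ J : H →L[ℂ] H, IsSelfAdjoint J ∧ J * J = 1 ∧ J * CFC.abs S = S ∧
      ∀ X : H →L[ℂ] H, IsSelfAdjoint X → Commute S X → Commute J X := by
  set K : Submodule ℂ H := (S⁺ : H →L[ℂ] H).ker with hK
  have : CompleteSpace K := (S⁺ : H →L[ℂ] H).isClosed_ker.completeSpace_coe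
  set Q : H →L[ℂ] H := K.starProjection with hQ
  have hQs : IsSelfAdjoint Q := isSelfAdjoint_starProjection K
  have hQQ : Q * Q = Q := K.isIdempotentElem_starProjection
  have hpos : IsSelfAdjoint (S⁺ : H →L[ℂ] H) := by cfc_tac
  have hpQ : S⁺ * Q = 0 := by
    ext v
    exact K.starProjection_apply_mem v
  have hQp : Q * S⁺ = 0 := by
    have h := congrArg star hpQ
    rwa [star_mul, hQs.star_eq, hpos.star_eq, star_zero] at h
  have hQn : Q * S⁻ = S⁻ := by
    ext v
    refine Submodule.starProjection_eq_self_iff.2 ?_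
    exact congrArg (fun T : H →L[ℂ] H => T v) (CFC.posPart_mul_negPart S)
  -- The reflection equal to `-1` on `ker S⁺`, which contains the range of `S⁻`, and to `1` on its
  -- orthogonal complement.
  refine ⟨1 - (2 : ℂ) • Q, ?_, ?_, ?_, fun X hX hSX => ?_⟩
  · refine (IsSelfAdjoint.one _).sub (IsSelfAdjoint.smul ?_ hQs)
    exact Complex.conj_ofNat 2
  · simp only [sub_mul, mul_sub, one_mul, mul_one, smul_mul_assoc, mul_smul_comm, hQQ]
    module
  · rw [← CFC.posPart_add_negPart S hS]
    simp only [sub_mul, mul_add, one_mul, smul_mul_assoc, hQp, hQn]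
    conv_rhs => rw [← CFC.posPart_sub_negPart S hS]
    module
  -- `X` commutes with `S⁺`, hence preserves its kernel; being self-adjoint, it then commutes with
  -- the projection.
  · have hpX : Commute (S⁺ : H →L[ℂ] H) X := hSX.cfcₙ_real _
    have h1 : Q * (X * Q) = X * Q := by
      ext v
      refine Submodule.starProjection_eq_self_iff.2 ?_
      have h : S⁺ * (X * Q) = 0 := by rw [← mul_assoc, hpX.eq, mul_assoc, hpQ, mul_zero]
      exact congrArg (fun T : H →L[ℂ] H => T v) h
    have h2 : Q * X * Q = Q * X := by
      have h := congrArg star h1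
      simpa only [star_mul, hQs.star_eq, hX.star_eq] using h
    have h3 : Commute Q X := by
      rw [Commute, SemiconjBy, ← h2, mul_assoc, h1]
    exact (Commute.one_left X).sub_left (h3.smul_left 2)

/-- Every unitary operator has a bounded self-adjoint logarithm with spectrum in `[-π, π]`,
expressed here through the cosine and sine of the logarithm. -/
theorem exists_isSelfAdjoint_cos_sin_eq {U : H →L[ℂ] H} (hU : U ∈ unitary (H →L[ℂ] H)) :
    ∃ A : H →L[ℂ] H, IsSelfAdjoint A ∧ (∀ x ∈ spectrum ℝ A, |x| ≤ Real.pi) ∧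
      cfc Real.cos A = (ℜ U : H →L[ℂ] H) ∧ cfc Real.sin A = (ℑ U : H →L[ℂ] H) := by
  obtain ⟨hn, hsq⟩ := mem_unitary_iff_isStarNormal_and_realPart_sq_add_imaginaryPart_sq_eq_one.1 hU
  have hcomm := Commute.realPart_imaginaryPart U
  have hspec : ∀ x ∈ spectrum ℝ (ℜ U : H →L[ℂ] H), -1 ≤ x ∧ x ≤ 1 := fun x hx => by
    have : Nontrivial (H →L[ℂ] H) := not_subsingleton_iff_nontrivial.1 fun _ => by
      simp [spectrum.of_subsingleton] at hx
    have := CStarRing.norm_of_mem_unitary hU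
    exact abs_le.1 ((spectrum.norm_le_norm_mul_of_mem hx).trans
      (by simpa [this] using realPart.norm_le U))
  have hC : IsSelfAdjoint (ℜ U : H →L[ℂ] H) := (ℜ U).2
  have hS : IsSelfAdjoint (ℑ U : H →L[ℂ] H) := (ℑ U).2
  generalize (ℜ U : H →L[ℂ] H) = C at *
  generalize (ℑ U : H →L[ℂ] H) = S at *
  obtain ⟨J, hJ, hJJ, hJS, hJX⟩ := hS.exists_symmetry_mul_abs
  set T := cfc Real.arccos C with hT
  have hTs : IsSelfAdjoint T := cfc_predicate _ _
  have hT0 : 0 ≤ T := cfc_nonneg fun x _ => Real.arccos_nonneg x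
  have hJT : Commute J T := (hcomm.cfc_real Real.arccos).symm |> hJX T hTs
  have hcosT : cfc Real.cos T = C := by
    rw [hT, ← cfc_comp' Real.cos Real.arccos C]
    conv_rhs => rw [← cfc_id ℝ C]
    exact cfc_congr fun x hx => Real.cos_arccos (hspec x hx).1 (hspec x hx).2
  have hsinT : cfc Real.sin T = CFC.abs S := by
    rw [hT, ← cfc_comp' Real.sin Real.arccos C, CFC.abs]
    symm
    refine CFC.sqrt_unique ?_ (cfc_nonneg fun x _ => Real.sin_nonneg_of_mem_Icc
      ⟨Real.arccos_nonneg x, Real.arccos_le_pi x⟩)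
    have hSS : star S * S = 1 - C ^ 2 := by rw [hS.star_eq, ← hsq]; noncomm_ring
    rw [hSS, ← cfc_mul _ _ C, ← cfc_one ℝ C, ← cfc_pow_id (R := ℝ) C 2, ← cfc_sub _ _ C]
    refine cfc_congr fun x hx => ?_
    have h : 0 ≤ 1 - x ^ 2 := by nlinarith [hspec x hx]
    simpa [Real.sin_arccos] using Real.mul_self_sqrt h
  have hA : IsSelfAdjoint (J * T) := (hJ.commute_iff hTs).1 hJT
  have habs : CFC.abs (J * T) = T := by
    rw [CFC.abs]
    refine CFC.sqrt_unique ?_ hT0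
    rw [hA.star_eq, hJT.symm.mul_mul_mul_comm, hJJ, one_mul]
  -- Since `|J T| = T`, even functions do not see the sign `J`. This settles `cos`; for `sin`, write
  -- `sin x = x * sinc x` with `sinc` even.
  have heven : ∀ f : ℝ → ℝ, Continuous f → (∀ x, f |x| = f x) → cfc f (J * T) = cfc f T := by
    intro f hf hfe
    conv_rhs => rw [← habs, CFC.abs_eq_cfc_norm (J * T) hA,
      ← cfc_comp' f (‖·‖) (J * T) hf.continuousOn]
    simp [hfe]
  refine ⟨J * T, hA, fun x hx => ?_, ?_, ?_⟩
  · have hx' : |x| ∈ spectrum ℝ T := by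
      rw [← habs, CFC.abs_eq_cfc_norm (J * T) hA, cfc_map_spectrum (‖·‖) (J * T)]
      exact ⟨x, hx, rfl⟩
    rw [hT, cfc_map_spectrum Real.arccos C] at hx'
    obtain ⟨y, -, hy⟩ := hx'
    exact hy ▸ Real.arccos_le_pi y
  · rw [heven _ Real.continuous_cos Real.cos_abs, hcosT]
  · have hsinc : ∀ B : H →L[ℂ] H, IsSelfAdjoint B → cfc Real.sin B = B * cfc Real.sinc B := by
      intro B hB
      conv_rhs => enter [1]; rw [← cfc_id ℝ B]
      rw [← cfc_mul _ _ B continuousOn_id Real.continuous_sinc.continuousOn]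
      refine cfc_congr fun x _ => ?_
      rcases eq_or_ne x 0 with rfl | hx
      · simp
      · simp [Real.sinc_of_ne_zero hx, mul_div_cancel₀ _ hx]
    have hse : ∀ x, Real.sinc |x| = Real.sinc x := fun x => by
      rcases abs_choice x with h | h <;> simp [h]
    rw [hsinc _ hA, heven _ Real.continuous_sinc hse, mul_assoc, ← hsinc T hTs, hsinT, hJS]

/-- Every unitary operator is `exp (i A)` for a bounded self-adjoint operator `A` with spectrum in
`[-π, π]`. -/
theorem exists_isSelfAdjoint_exp_eq {U : H →L[ℂ] H} (hU : U ∈ unitary (H →L[ℂ] H)) :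
    ∃ A : H →L[ℂ] H, IsSelfAdjoint A ∧ (∀ x ∈ spectrum ℝ A, |x| ≤ Real.pi) ∧
      cfc (fun z : ℂ => Complex.exp (z * Complex.I)) A = U := by
  obtain ⟨A, hA, hspec, hcos, hsin⟩ := exists_isSelfAdjoint_cos_sin_eq hU
  refine ⟨A, hA, hspec, ?_⟩
  have hn : IsStarNormal A := hA.isStarNormal
  rw [← realPart_add_I_smul_imaginaryPart U, ← hcos, ← hsin, cfc_real_eq_complex _ hA,
    cfc_real_eq_complex _ hA, ← cfc_smul Complex.I _ A, ← cfc_add A _ _]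
  refine cfc_congr fun z hz => ?_
  have hz' : (z.re : ℂ) = z := (hA.mem_spectrum_eq_re hz).symm
  simp only [Complex.ofReal_cos, Complex.ofReal_sin, hz', smul_eq_mul]
  rw [Complex.exp_mul_I, mul_comm Complex.I]

end Logarithm

/-! ### One-parameter groups from cocycles -/

namespace AffineIsometryGroup

variable {H : Type*} [NormedAddCommGroup H] [InnerProductSpace ℂ H] [CompleteSpace H]

/-- A norm continuous one-parameter unitary group together with a continuous cocycle defines a
continuous one-parameter group of affine isometries. -/
theorem exists_monoidHom_of_cocycle (V : ℝ → unitary (H →L[ℂ] H)) (b : ℝ → H)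
    (hV : Continuous V) (hb : Continuous b) (hVadd : ∀ s t, V (s + t) = V s * V t)
    (hbadd : ∀ s t, b (s + t) = (V s : H →L[ℂ] H) (b t) + b s) :
    ∃ β : Multiplicative ℝ →* (H ≃ᵃⁱ[ℂ] H), Continuous β ∧
      ∀ t, equivProdUnitary H (β (Multiplicative.ofAdd t)) = (b t, V t) := by
  refine ⟨MonoidHom.mk' (fun t => (equivProdUnitary H).symm (b t.toAdd, V t.toAdd))
    fun s t => (equivProdUnitary H).injective ?_, ?_, fun t => ?_⟩
  · simp only [equivProdUnitary_mul, Equiv.apply_symm_apply, toAdd_mul, hVadd, hbadd]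
  · refine continuous_induced_rng.2 ?_
    simpa [Function.comp_def] using!
      (hb.comp continuous_toAdd).prodMk (hV.comp continuous_toAdd)
  · simp

/-- The action of a continuous one-parameter group of affine isometries is jointly continuous. -/
theorem continuous_action {β : Multiplicative ℝ →* (H ≃ᵃⁱ[ℂ] H)} (hβ : Continuous β) :
    Continuous fun p : ℝ × H => β (Multiplicative.ofAdd p.1) p.2 := by
  have h : Continuous fun p : ℝ × H => equivProdUnitary H (β (Multiplicative.ofAdd p.1)) :=
    continuous_equivProdUnitary.comp (hβ.comp (continuous_ofAdd.comp continuous_fst))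
  simp only [apply_eq]
  exact ((continuous_subtype_val.comp h.snd).clm_apply continuous_snd).add h.fst

end AffineIsometryGroup

/-! ### The scalar cocycle and its zeros at time 1 -/

section Primitive

open Complex intervalIntegral

/-- The primitive in `t`, vanishing at `t = 0`, of the exponential `t ↦ exp (i t z)`. -/
noncomputable def expIPrimitive (t : ℝ) (z : ℂ) : ℂ := ∫ s in (0 : ℝ)..t, exp (s * z * I)

theorem continuous_expIPrimitive : Continuous fun p : ℝ × ℂ => expIPrimitive p.1 p.2 :=
  continuous_parametric_intervalIntegral_of_continuous (f := fun (p : ℝ × ℂ) (s : ℝ) =>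
    exp (s * p.2 * I)) (by fun_prop) continuous_fst

/-- Split the integral at `s` and translate the second piece. Under functional calculus this becomes
the cocycle identity. -/
theorem expIPrimitive_add (s t : ℝ) (z : ℂ) :
    expIPrimitive (s + t) z = exp (s * z * I) * expIPrimitive t z + expIPrimitive s z := by
  have hi : ∀ a b : ℝ, IntervalIntegrable (fun r : ℝ => exp (r * z * I)) MeasureTheory.volume a b :=
    fun a b => Continuous.intervalIntegrable (by fun_prop) a b
  have h : exp (s * z * I) * expIPrimitive t z = ∫ r in s..s + t, exp (r * z * I) := by
    have h1 := integral_comp_add_right (a := 0) (b := t) (fun r : ℝ => exp (r * z * I)) s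
    rw [zero_add, add_comm t s] at h1
    rw [← h1, expIPrimitive, ← integral_const_mul]
    congr 1 with r
    rw [← exp_add]
    push_cast
    ring_nf
  rw [h, add_comm _ (expIPrimitive s z)]
  exact (integral_add_adjacent_intervals (hi 0 s) (hi s (s + t))).symm

theorem expIPrimitive_one_ne_zero {x : ℝ} (hx : |x| ≤ Real.pi) : expIPrimitive 1 x ≠ 0 := by
  rcases eq_or_ne x 0 with rfl | h0
  · simp [expIPrimitive]
  have hc : (x : ℂ) * I ≠ 0 := mul_ne_zero (ofReal_ne_zero.2 h0) I_ne_zero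
  have h : expIPrimitive 1 x = (exp (x * I) - 1) / (x * I) := by
    have h1 := integral_exp_mul_complex (a := 0) (b := 1) hc
    simp only [ofReal_one, ofReal_zero, mul_one, mul_zero, exp_zero] at h1
    rw [← h1, expIPrimitive]
    congr 1 with s
    ring_nf
  rw [h]
  refine div_ne_zero (fun h1 => ?_) hc
  obtain ⟨n, hn⟩ := exp_eq_one_iff.1 (sub_eq_zero.1 h1)
  have hn' : x = n * (2 * Real.pi) := by
    have := mul_right_cancel₀ I_ne_zero (hn.trans (by ring : _ = (n * (2 * Real.pi) : ℂ) * I))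
    exact_mod_cast this
  have hn0 : n ≠ 0 := by
    rintro rfl
    simp_all
  have hn1 : (1 : ℝ) ≤ |(n : ℝ)| := by exact_mod_cast Int.one_le_abs hn0
  rw [hn', abs_mul, abs_of_pos (by positivity : (0 : ℝ) < 2 * Real.pi)] at hx
  nlinarith [Real.pi_pos]

end Primitive

/-! ### Exponentiality and extension of actions -/

theorem AffineIsometryGroup.isExponentialGroup (H : Type*) [NormedAddCommGroup H]
    [InnerProductSpace ℂ H] [CompleteSpace H] : IsExponentialGroup (H ≃ᵃⁱ[ℂ] H) := by
  intro g
  obtain ⟨A, hA, hspec, hexp⟩ := exists_isSelfAdjoint_exp_eq (equivProdUnitary H g).2.2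
  have hn : IsStarNormal A := hA.isStarNormal
  have hre : ∀ z ∈ spectrum ℂ A, z = (z.re : ℂ) := fun z hz => hA.mem_spectrum_eq_re hz
  set E : ℝ → ℂ → ℂ := fun t z => Complex.exp (t * z * Complex.I) with hE
  have hEc : Continuous fun p : ℝ × ℂ => E p.1 p.2 := by fun_prop
  have hEt : ∀ t, Continuous (E t) := fun t => by fun_prop
  have hψt : ∀ t, Continuous (expIPrimitive t) := fun t =>
    continuous_expIPrimitive.comp (by fun_prop : Continuous fun z : ℂ => (t, z))
  -- The spectrum is compact, so joint continuity makes `F s` tend to `F t` uniformly on it as `s →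
  -- t`; this gives norm continuity.
  have hcont : ∀ F : ℝ → ℂ → ℂ, (Continuous fun p : ℝ × ℂ => F p.1 p.2) →
      Continuous fun t => cfc (F t) A := by
    intro F hF
    refine continuous_iff_continuousAt.2 fun t => continuousAt_cfc_fun (fun u hu => ?_)
      (.of_forall fun s => (hF.comp (by fun_prop : Continuous fun z : ℂ => (s, z))).continuousOn)
    obtain ⟨v, hv, hvu⟩ := (ContinuousFunctionalCalculus.isCompact_spectrum
      (R := ℂ) A).mem_uniformity_of_prod (f := F) (s := Set.univ) hF.continuousOn
      (Set.mem_univ t) (symm_le_uniformity hu)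
    filter_upwards [nhdsWithin_univ t ▸ hv] with s hs z hz using hvu s hs z hz
  have hunit : ∀ t, cfc (E t) A ∈ unitary (H →L[ℂ] H) := fun t => by
    refine (cfc_unitary_iff (E t) A hn (hEt t).continuousOn).2 fun z hz => ?_
    rw [hre z hz]
    simp only [hE, RCLike.star_def, ← Complex.exp_conj, ← Complex.exp_add]
    simp
  have hunit1 : IsUnit (cfc (expIPrimitive 1) A) := by
    refine (isUnit_cfc_iff _ A (hψt 1).continuousOn hn).2 fun z hz => ?_
    rw [hre z hz]
    refine expIPrimitive_one_ne_zero (hspec _ ?_)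
    exact hA.spectrumRestricts.apply_mem hz
  obtain ⟨W, hW⟩ := hunit1.exists_right_inv
  -- Chosen so that the cocycle at time 1 is the translation part of `g`.
  set c : H := W (equivProdUnitary H g).1
  obtain ⟨β, hβ, hβe⟩ := exists_monoidHom_of_cocycle (fun t => ⟨cfc (E t) A, hunit t⟩)
    (fun t => cfc (expIPrimitive t) A c) ((hcont E hEc).subtype_mk _)
    ((hcont _ continuous_expIPrimitive).clm_apply continuous_const)
    (fun s t => Subtype.ext <| by
      simp only [Submonoid.mk_mul_mk]
      rw [← cfc_mul _ _ A (hEt s).continuousOn (hEt t).continuousOn]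
      refine cfc_congr fun z _ => ?_
      simp only [hE, ← Complex.exp_add]
      push_cast
      ring_nf)
    (fun s t => by
      have h : cfc (expIPrimitive (s + t)) A =
          cfc (E s) A * cfc (expIPrimitive t) A + cfc (expIPrimitive s) A := by
        rw [← cfc_mul _ _ A (hEt s).continuousOn (hψt t).continuousOn,
          ← cfc_add A (fun z => E s z * expIPrimitive t z) _ ((hEt s).mul (hψt t)).continuousOn
            (hψt s).continuousOn]
        exact cfc_congr fun z _ => expIPrimitive_add s t z
      simp [h])
  refine ⟨β, hβ, (equivProdUnitary H).injective ?_⟩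
  rw [hβe]
  refine Prod.ext ?_ (Subtype.ext ?_)
  · exact congrArg (fun T : H →L[ℂ] H => T (equivProdUnitary H g).1) hW
  · simpa [hE] using hexp

theorem mainTheorem12 (H : Type*) [NormedAddCommGroup H] [InnerProductSpace ℂ H]
    [CompleteSpace H] :
    -- The group of affine isometries of `H` is exponential.
    IsExponentialGroup (H ≃ᵃⁱ[ℂ] H) ∧
    -- Every action of `ℤ` on `H` by affine isometries extends to a continuous action of `ℝ`.
    ∀ α : Multiplicative ℤ →* (H ≃ᵃⁱ[ℂ] H),
      ∃ β : Multiplicative ℝ →* (H ≃ᵃⁱ[ℂ] H),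
        Continuous β ∧
        Continuous (fun p : ℝ × H => β (Multiplicative.ofAdd p.1) p.2) ∧
        ∀ n : ℤ, β (Multiplicative.ofAdd (n : ℝ)) = α (Multiplicative.ofAdd n) := by
  have hexp := AffineIsometryGroup.isExponentialGroup H
  refine ⟨hexp, fun α => ?_⟩
  obtain ⟨β, hβ, hβ1⟩ := hexp (α (Multiplicative.ofAdd 1))
  refine ⟨β, hβ, AffineIsometryGroup.continuous_action hβ, fun n => ?_⟩
  have hR : Multiplicative.ofAdd (n : ℝ) = Multiplicative.ofAdd (1 : ℝ) ^ n := by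
    simp [← ofAdd_zsmul]
  have hZ : Multiplicative.ofAdd n = Multiplicative.ofAdd (1 : ℤ) ^ n := by
    simp [← ofAdd_zsmul]
  rw [hR, hZ, map_zpow, map_zpow, hβ1]
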